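/- For an integer $n\ge 2$ let $x_i=\frac{2i}{n-1}-1$, $i=0,\dots,n-1$, be the uniform grid on $[-1,1]$. For an angle $\nu$ and $(s,t)\in\mathbb R^2$ put $$\tau_\nu(s,t)=(s\cos\nu+t\sin\nu,\;-s\sin\nu+t\cos\nu),$$ and let $X\in\mathbb R^{n\times n}$ be the directly sampled image of the square $[-\alpha,\alpha]^2$ rotated by $\nu=\pi/4$, with $\alpha=1/\sqrt2$ (a "diamond"): $$X_{ij}=\begin{cases}1 & \text{if } \|\tau_{\pi/4}(x_i,x_j)\|_\infty\le 1/\sqrt2,\\ 0&\text{otherwise,}\end{cases}\qquad 0\le i,j\le n-1.$$ **Theorem.** There are absolute constants $c,C,C'>0$ such that the following holds. For all integers $n\ge 2$ and $k\ge 0$ with $n\ge\max\{C,\;C'k^{9.5}\}$, every matrix $\hat X\in\mathbb R^{n\times n}$ of rank at most $k$ satisfies $$\frac1{n^2}\,\|\hat X-X\|_F^2\;\ge\;\frac{c}{1+k}.$$ -/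

import Mathlib

open scoped Matrix.Norms.Frobenius

/-- The `i`-th coordinate of the uniform grid `-1, -1 + 2/(n-1), …, 1` with `n` points. -/
noncomputable def gridCoord (n : ℕ) (i : Fin n) : ℝ :=
  2 / ((n : ℝ) - 1) * (i : ℝ) - 1

/-- The rotation field `τ_ν` at a point `(s, t)`: the transpose of the rotation matrix
`!![cos ν, -sin ν; sin ν, cos ν]` applied to `(s, t)`. -/
noncomputable def rotationField (ν s t : ℝ) : Fin 2 → ℝ :=
  ![Real.cos ν * s + Real.sin ν * t, -Real.sin ν * s + Real.cos ν * t]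

/-- The directly sampled `n × n` image of the square `[-α, α]²` rotated by the angle `ν`: the
entry at a grid point is `1` if `‖τ_ν‖_∞ ≤ α` there, and `0` otherwise
(the norm on `Fin 2 → ℝ` is the sup norm). -/
noncomputable def directlySampledImage (n : ℕ) (ν α : ℝ) : Matrix (Fin n) (Fin n) ℝ :=
  Matrix.of fun i j => if ‖rotationField ν (gridCoord n i) (gridCoord n j)‖ ≤ α then 1 else 0

/-!
The grid point `(x_i, x_j)` lies in the diamond exactly when `|x_i| + |x_j| ≤ 1`. In the quadrant
where both coordinates are nonpositive this reads `n - 1 ≤ 2 * (i + j)`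
(`directlySampledImage_apply`), so there the image is, up to reversing the rows, a triangular
matrix of ones. A triangular matrix of ones has singular values decaying only like `n / l`. Rather
than computing them, the proof tests the matrix against vectors with disjoint supports.

Take `r = 2 * (k + 1)` consecutive groups of `3 * L` indices, with `L` of order `n / r`. The `l`-th
column vector is `1` on the last third of the `l`-th group, `-1` on the first third; the `l`-th row
vector is `1` on the (reversed) middle third. Since each column vector has mean zero, testing
against distinct groups gives `0`, while testing against equal groups gives `L * L`: the
compressed `r × r` matrix is `L ^ 2` times the identity
(`signedBlockSum_directlySampledImage`).
Compression does not increase the rank (`rank_signedBlockSum_le`), and by Cauchy–Schwarz it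
increases the squared Frobenius norm by a factor at most `2 * L ^ 2`
(`sum_sq_signedBlockSum_le`). Finally, a matrix of rank at most `k` is at squared distance at least
`σ ^ 2 * (r - k)` from `σ • 1` (`sq_mul_sub_rank_le_sum_sq`), by Bessel's inequality on its kernel.
Hence the squared error is at least `L ^ 2 * (k + 2) / 2`, which is of order `n ^ 2 / (k + 1)`.
The groups fit into the quadrant once `n` exceeds a constant multiple of `k + 1`.
-/

open Matrix

/-! ### Distance of a scalar matrix to matrices of small rank -/

/-- On the kernel of `A`, the matrix `A - σ • 1` acts as the scalar `-σ`; Bessel's inequality for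
an orthonormal basis of the kernel, applied to each row, bounds the Frobenius norm from below. -/
lemma sq_mul_sub_rank_le_sum_sq {ι : Type*} [Fintype ι] [DecidableEq ι] (A : Matrix ι ι ℝ)
    (σ : ℝ) :
    σ ^ 2 * ((Fintype.card ι : ℝ) - A.rank) ≤
      ∑ i, ∑ j, (A i j - (σ • (1 : Matrix ι ι ℝ)) i j) ^ 2 := by
  set T : EuclideanSpace ℝ ι →ₗ[ℝ] EuclideanSpace ℝ ι := Matrix.toEuclideanLin A with hT
  have hrank : A.rank = Module.finrank ℝ (LinearMap.range T) := by
    rw [hT, Matrix.toEuclideanLin_eq_toLin_orthonormal]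
    exact Matrix.rank_eq_finrank_range_toLin A _ _
  have hker : (Fintype.card ι : ℝ) - A.rank = Module.finrank ℝ (LinearMap.ker T) := by
    have h := LinearMap.finrank_range_add_finrank_ker T
    rw [finrank_euclideanSpace, ← hrank] at h
    rw [← h]; push_cast; ring
  let b := stdOrthonormalBasis ℝ (LinearMap.ker T)
  let v : Fin (Module.finrank ℝ (LinearMap.ker T)) → EuclideanSpace ℝ ι := fun s => (b s : _)
  have hv : Orthonormal ℝ v :=
    b.orthonormal.comp_linearIsometry (LinearMap.ker T).subtypeₗᵢ
  let w : ι → EuclideanSpace ℝ ι :=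
    fun i => WithLp.toLp 2 fun j => A i j - (σ • (1 : Matrix ι ι ℝ)) i j
  have hinner : ∀ s i, inner ℝ (v s) (w i) = -σ * v s i := by
    intro s i
    have h0 : T (v s) = 0 := (b s).2
    have h1 : ∑ j, A i j * v s j = 0 := by
      have := congrArg (fun u : EuclideanSpace ℝ ι => u i) h0
      simpa [hT, Matrix.toLpLin_apply, Matrix.mulVec, dotProduct] using this
    have h2 : ∑ j, (σ • (1 : Matrix ι ι ℝ)) i j * v s j = σ * v s i := by
      simp [Matrix.one_apply]
    simp only [PiLp.inner_apply, w, RCLike.inner_apply, conj_trivial, sub_mul,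
      Finset.sum_sub_distrib, h1, h2]
    ring
  have hnorm : ∀ s, ∑ i, v s i ^ 2 = 1 := by
    intro s
    rw [← EuclideanSpace.real_norm_sq_eq, hv.1 s, one_pow]
  calc σ ^ 2 * ((Fintype.card ι : ℝ) - A.rank)
      = ∑ s : Fin (Module.finrank ℝ (LinearMap.ker T)), ∑ i, ‖inner ℝ (v s) (w i)‖ ^ 2 := by
        simp_rw [hinner, Real.norm_eq_abs, sq_abs, mul_pow, ← Finset.mul_sum, hnorm, hker]
        simp [mul_comm]
    _ = ∑ i, ∑ s, ‖inner ℝ (v s) (w i)‖ ^ 2 := Finset.sum_comm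
    _ ≤ ∑ i, ‖w i‖ ^ 2 := Finset.sum_le_sum fun i _ => hv.sum_inner_products_le (w i)
    _ = _ := by simp_rw [EuclideanSpace.real_norm_sq_eq]; rfl

/-! ### Compression of a matrix to signed block sums -/

/-- The matrix of signed block sums of `E`: the `(l, l')` entry adds up the entries of `E` in the
rows `f (l, a)` and the columns `g (l', b)`, the latter weighted by `s b`. -/
noncomputable def signedBlockSum {ι α β m n : Type*} [Fintype α] [Fintype β]
    (f : ι × α → m) (g : ι × β → n) (s : β → ℝ) (E : Matrix m n ℝ) : Matrix ι ι ℝ :=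
  Matrix.of fun l l' => ∑ a, ∑ b, s b * E (f (l, a)) (g (l', b))

lemma signedBlockSum_sub {ι α β m n : Type*} [Fintype α] [Fintype β]
    (f : ι × α → m) (g : ι × β → n) (s : β → ℝ) (E F : Matrix m n ℝ) :
    signedBlockSum f g s (E - F) = signedBlockSum f g s E - signedBlockSum f g s F := by
  ext l l'
  simp [signedBlockSum, mul_sub, Finset.sum_sub_distrib]

/-- A matrix of signed block sums of `E` is a product `U * E * V`. -/
lemma rank_signedBlockSum_le {ι α β m n : Type*} [Fintype ι] [Fintype α] [Fintype β] [Fintype m]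
    [Fintype n] [DecidableEq m] [DecidableEq n]
    (f : ι × α → m) (g : ι × β → n) (s : β → ℝ) (E : Matrix m n ℝ) :
    (signedBlockSum f g s E).rank ≤ E.rank := by
  let U : Matrix ι m ℝ := Matrix.of fun l i => ∑ a, if f (l, a) = i then 1 else 0
  let V : Matrix n ι ℝ := Matrix.of fun j l => ∑ b, if g (l, b) = j then s b else 0
  have h : signedBlockSum f g s E = U * (E * V) := by
    ext l l'
    have h1 : ∀ i, (E * V) i l' = ∑ b, s b * E i (g (l', b)) := by
      intro i
      simp only [Matrix.mul_apply, V, Matrix.of_apply, Finset.mul_sum]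
      rw [Finset.sum_comm]
      simp [mul_comm]
    rw [Matrix.mul_apply]
    simp only [h1, U, Matrix.of_apply]
    simp only [Finset.sum_mul]
    rw [Finset.sum_comm]
    simp [signedBlockSum]
  rw [h]
  exact (Matrix.rank_mul_le_right _ _).trans (Matrix.rank_mul_le_left _ _)

/-- Each signed block sum is estimated by Cauchy–Schwarz, and distinct blocks are disjoint. -/
lemma sum_sq_signedBlockSum_le {ι α β m n : Type*} [Fintype ι] [Fintype α] [Fintype β] [Fintype m]
    [Fintype n] {f : ι × α → m} {g : ι × β → n} (hf : f.Injective) (hg : g.Injective)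
    {s : β → ℝ} (hs : ∀ b, s b ^ 2 = 1) (E : Matrix m n ℝ) :
    ∑ l, ∑ l', signedBlockSum f g s E l l' ^ 2 ≤
      (Fintype.card α * Fintype.card β : ℝ) * ∑ i, ∑ j, E i j ^ 2 := by
  have h1 : ∀ l l', signedBlockSum f g s E l l' ^ 2 ≤
      (Fintype.card α * Fintype.card β : ℝ) * ∑ a, ∑ b, E (f (l, a)) (g (l', b)) ^ 2 := by
    intro l l'
    have h := sq_sum_le_card_mul_sum_sq (s := (Finset.univ : Finset (α × β)))
      (f := fun p => s p.2 * E (f (l, p.1)) (g (l', p.2)))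
    simpa [Fintype.sum_prod_type, mul_pow, hs, signedBlockSum] using h
  have h2 : ∑ l, ∑ l', ∑ a, ∑ b, E (f (l, a)) (g (l', b)) ^ 2
      = ∑ p, ∑ q, E (f p) (g q) ^ 2 := by
    simp only [Fintype.sum_prod_type]
    exact Finset.sum_congr rfl fun l _ => Finset.sum_comm
  have hg' : ∀ i, ∑ q, E i (g q) ^ 2 ≤ ∑ j, E i j ^ 2 := fun i => by
    classical
    rw [← Finset.sum_image (f := fun j => E i j ^ 2) (hg.injOn)]
    exact Finset.sum_le_sum_of_subset_of_nonneg (Finset.subset_univ _) fun _ _ _ => sq_nonneg _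
  have hf' : ∑ p, ∑ j, E (f p) j ^ 2 ≤ ∑ i, ∑ j, E i j ^ 2 := by
    classical
    rw [← Finset.sum_image (f := fun i => ∑ j, E i j ^ 2) (hf.injOn)]
    exact Finset.sum_le_sum_of_subset_of_nonneg (Finset.subset_univ _)
      fun _ _ _ => Finset.sum_nonneg fun _ _ => sq_nonneg _
  calc ∑ l, ∑ l', signedBlockSum f g s E l l' ^ 2
      ≤ ∑ l, ∑ l', (Fintype.card α * Fintype.card β : ℝ) *
          ∑ a, ∑ b, E (f (l, a)) (g (l', b)) ^ 2 :=
        Finset.sum_le_sum fun l _ => Finset.sum_le_sum fun l' _ => h1 l l'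
    _ = (Fintype.card α * Fintype.card β : ℝ) * ∑ p, ∑ q, E (f p) (g q) ^ 2 := by
        rw [← h2]; simp only [Finset.mul_sum]
    _ ≤ _ := by
        refine mul_le_mul_of_nonneg_left ?_ (by positivity)
        exact (Finset.sum_le_sum fun p _ => hg' (f p)).trans hf'

/-! ### The diamond in a quadrant of the grid -/

lemma norm_rotationField_pi_div_four_le_iff (s t : ℝ) :
    ‖rotationField (Real.pi / 4) s t‖ ≤ 1 / Real.sqrt 2 ↔ |s + t| ≤ 1 ∧ |t - s| ≤ 1 := by
  have h2 : (0 : ℝ) < Real.sqrt 2 / 2 := by positivity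
  have h1 : 1 / Real.sqrt 2 = Real.sqrt 2 / 2 := by
    rw [div_eq_div_iff (by positivity) (by norm_num)]; simp
  have key : ∀ x : ℝ, |Real.sqrt 2 / 2 * x| ≤ Real.sqrt 2 / 2 ↔ |x| ≤ 1 := fun x => by
    rw [abs_mul, abs_of_pos h2]; exact mul_le_iff_le_one_right h2
  rw [h1, pi_norm_le_iff_of_nonneg h2.le, Fin.forall_fin_two, ← key, ← key]
  simp only [rotationField, Real.cos_pi_div_four, Real.sin_pi_div_four, Matrix.cons_val_zero,
    Matrix.cons_val_one, Real.norm_eq_abs]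
  ring_nf

/-- In the quadrant of nonpositive coordinates the sampled diamond is a triangle of ones. The
number `n / 2` is the integer part, equal to `(n - 1) / 2` rounded up. -/
lemma directlySampledImage_apply {n : ℕ} (hn : 2 ≤ n) (i j : Fin n) (hi : 2 * (i : ℕ) + 1 ≤ n)
    (hj : 2 * (j : ℕ) + 1 ≤ n) :
    directlySampledImage n (Real.pi / 4) (1 / Real.sqrt 2) i j =
      if n / 2 ≤ (i : ℕ) + j then 1 else 0 := by
  have hn' : (0 : ℝ) < (n : ℝ) - 1 := by
    have : (2 : ℝ) ≤ n := by exact_mod_cast hn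
    linarith
  have hi' : (2 : ℝ) * i + 1 ≤ n := by exact_mod_cast hi
  have hj' : (2 : ℝ) * j + 1 ≤ n := by exact_mod_cast hj
  have hx : ∀ y : ℝ, 2 / ((n : ℝ) - 1) * y = 2 * y / ((n : ℝ) - 1) := fun y => by ring
  have hbound : ∀ y : ℝ, 0 ≤ y → 2 * y + 1 ≤ n →
      -1 ≤ 2 / ((n : ℝ) - 1) * y - 1 ∧ 2 / ((n : ℝ) - 1) * y - 1 ≤ 0 := by
    intro y h0 h1
    have h2 : 0 ≤ 2 / ((n : ℝ) - 1) * y := by positivity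
    have h3 : 2 / ((n : ℝ) - 1) * y ≤ 1 := by rw [hx, div_le_one hn']; linarith
    constructor <;> linarith
  obtain ⟨hi1, hi2⟩ := hbound i (by positivity) hi'
  obtain ⟨hj1, hj2⟩ := hbound j (by positivity) hj'
  have hiff : 1 ≤ 2 / ((n : ℝ) - 1) * i + 2 / ((n : ℝ) - 1) * j ↔ n / 2 ≤ (i : ℕ) + j := by
    rw [← mul_add, hx, le_div_iff₀ hn', one_mul, sub_le_iff_le_add]
    have h : n ≤ 2 * ((i : ℕ) + j) + 1 ↔ n / 2 ≤ (i : ℕ) + j := by omega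
    rw [← h]
    exact_mod_cast Iff.rfl
  rw [directlySampledImage, Matrix.of_apply]
  refine if_congr ?_ rfl rfl
  rw [norm_rotationField_pi_div_four_le_iff, ← hiff, gridCoord, gridCoord, abs_le, abs_le]
  constructor
  · rintro ⟨⟨h, -⟩, -⟩; linarith
  · intro h; refine ⟨⟨?_, ?_⟩, ?_, ?_⟩ <;> linarith

/-! ### The blocks -/

lemma mul_add_inj_of_lt {L a b x y : ℕ} (hx : x < L) (hy : y < L)
    (h : L * a + x = L * b + y) : a = b ∧ x = y := by
  have h1 : (L * a + x) / L = a := by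
    rw [Nat.mul_add_div (by omega), Nat.div_eq_of_lt hx, add_zero]
  have h2 : (L * b + y) / L = b := by
    rw [Nat.mul_add_div (by omega), Nat.div_eq_of_lt hy, add_zero]
  have hab : a = b := by rw [← h1, h, h2]
  subst hab
  exact ⟨rfl, by omega⟩

lemma mul_add_lt_of_le {L r q l c x : ℕ} (h : L * (3 * r) ≤ q) (hl : l < r) (hc : c ≤ 2)
    (hx : x < L) : L * (3 * l + c) + x < q := by
  have h1 : L * (3 * l + c + 1) ≤ L * (3 * r) := Nat.mul_le_mul_left L (by omega)
  rw [mul_add, mul_one] at h1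
  omega

lemma mul_add_le_mul_add_iff {L a b x y : ℕ} (hx : x < L) (hy : y < L) (hab : a ≠ b) :
    L * a + x ≤ L * b + y ↔ a < b := by
  constructor
  · intro h
    by_contra hlt
    have h1 : L * (b + 1) ≤ L * a := Nat.mul_le_mul_left L (by omega)
    rw [mul_add, mul_one] at h1
    omega
  · intro h
    have h1 : L * (a + 1) ≤ L * b := Nat.mul_le_mul_left L (by omega)
    rw [mul_add, mul_one] at h1
    omega

/-- The rows of the blocks: the middle thirds of the groups, counted backwards from `n / 2`. -/
def blockRow {n r L : ℕ} (h : L * (3 * r) ≤ n / 2) (p : Fin r × Fin L) : Fin n :=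
  ⟨n / 2 - (L * (3 * p.1 + 1) + p.2), by
    have := mul_add_lt_of_le h p.1.2 one_le_two p.2.2
    omega⟩

/-- The columns of the blocks: the last third of each group for `true`, the first for `false`. -/
def blockCol {n r L : ℕ} (h : L * (3 * r) ≤ n / 2) (p : Fin r × (Bool × Fin L)) : Fin n :=
  ⟨L * (3 * p.1 + if p.2.1 then 2 else 0) + p.2.2, by
    have := mul_add_lt_of_le h p.1.2 (c := if p.2.1 then 2 else 0) (by split_ifs <;> omega) p.2.2.2
    omega⟩

/-- The weights making the sum over each group of columns vanish. -/
def blockSign {L : ℕ} (p : Bool × Fin L) : ℝ := if p.1 then 1 else -1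

lemma blockRow_injective {n r L : ℕ} (h : L * (3 * r) ≤ n / 2) :
    (blockRow h).Injective := by
  rintro ⟨l, x⟩ ⟨l', x'⟩ hp
  have h1 := mul_add_lt_of_le h l.2 one_le_two x.2
  have h2 := mul_add_lt_of_le h l'.2 one_le_two x'.2
  simp only [blockRow, Fin.mk.injEq] at hp
  obtain ⟨h3, h4⟩ := mul_add_inj_of_lt (L := L) (a := 3 * l + 1) (b := 3 * l' + 1) x.2 x'.2
    (by omega)
  ext
  · show (l : ℕ) = l'
    omega
  · exact h4

lemma blockCol_injective {n r L : ℕ} (h : L * (3 * r) ≤ n / 2) :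
    (blockCol h).Injective := by
  rintro ⟨l, b, x⟩ ⟨l', b', x'⟩ hp
  simp only [blockCol, Fin.mk.injEq] at hp
  obtain ⟨h3, h4⟩ := mul_add_inj_of_lt x.2 x'.2 hp
  have hl : l = l' := by ext; cases b <;> cases b' <;> simp at h3 <;> omega
  have hb : b = b' := by subst hl; cases b <;> cases b' <;> simp at h3 <;> rfl
  rw [hl, hb, Fin.ext h4]

lemma directlySampledImage_blockRow_blockCol {n r L : ℕ} (hn : 2 ≤ n) (h : L * (3 * r) ≤ n / 2)
    (l l' : Fin r) (x y : Fin L) (b : Bool) :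
    directlySampledImage n (Real.pi / 4) (1 / Real.sqrt 2) (blockRow h (l, x))
      (blockCol h (l', (b, y))) = if (if b then l ≤ l' else l < l') then 1 else 0 := by
  have h1 := mul_add_lt_of_le h l.2 one_le_two x.2
  have h2 := mul_add_lt_of_le h l'.2 (c := if b then 2 else 0) (by split_ifs <;> omega) y.2
  -- The middle third of the first group is nonempty, hence `L * (3 * l + 1)` is positive.
  have h3 : 0 < L * (3 * (l : ℕ) + 1) := Nat.mul_pos (by have := x.2; omega) (by omega)
  have h4 := mul_add_le_mul_add_iff (a := 3 * (l : ℕ) + 1) (b := 3 * (l' : ℕ) + if b then 2 else 0)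
    x.2 y.2 (by split_ifs <;> omega)
  rw [directlySampledImage_apply hn]
  · refine if_congr ?_ rfl rfl
    have h5 : n / 2 ≤ ((blockRow h (l, x) : Fin n) : ℕ) + (blockCol h (l', (b, y)) : Fin n) ↔
        L * (3 * (l : ℕ) + 1) + x ≤ L * (3 * (l' : ℕ) + if b then 2 else 0) + y := by
      simp only [blockRow, blockCol]
      omega
    rw [h5, h4]
    cases b
    · simp only [Bool.false_eq_true, if_false, Fin.lt_def]; omega
    · simp only [if_true, Fin.le_def]; omega
  · simp only [blockRow]; omega
  · simp only [blockCol]; omega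

lemma signedBlockSum_directlySampledImage {n r L : ℕ} (hn : 2 ≤ n) (h : L * (3 * r) ≤ n / 2) :
    signedBlockSum (blockRow h) (blockCol h) blockSign
      (directlySampledImage n (Real.pi / 4) (1 / Real.sqrt 2)) =
      (L : ℝ) ^ 2 • (1 : Matrix (Fin r) (Fin r) ℝ) := by
  ext l l'
  simp only [signedBlockSum, Matrix.of_apply, directlySampledImage_blockRow_blockCol hn,
    Fintype.sum_prod_type, Fintype.sum_bool, blockSign, Matrix.smul_apply, Matrix.one_apply]
  rcases lt_trichotomy l l' with hl | rfl | hl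
  · simp [hl, hl.le, hl.ne]
  · simp [sq]
  · simp [hl.not_ge, hl.not_gt, hl.ne']

/-! ### The lower bound -/

lemma sq_frobenius_norm_eq_sum {m n : Type*} [Fintype m] [Fintype n] (A : Matrix m n ℝ) :
    ‖A‖ ^ 2 = ∑ i, ∑ j, A i j ^ 2 := by
  rw [Matrix.frobenius_norm_def, ← Real.sqrt_eq_rpow, Real.sq_sqrt (by positivity)]
  simp

/-- The error bound in terms of the block length `L`, for `r` groups of `3 * L` indices. -/
lemma sq_mul_sub_le_sq_norm_sub_directlySampledImage {n r L k : ℕ} (hn : 2 ≤ n) (hL : 0 < L)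
    (h : L * (3 * r) ≤ n / 2) {Y : Matrix (Fin n) (Fin n) ℝ} (hY : Y.rank ≤ k) :
    (L : ℝ) ^ 2 * ((r : ℝ) - k) ≤
      2 * ‖Y - directlySampledImage n (Real.pi / 4) (1 / Real.sqrt 2)‖ ^ 2 := by
  set X := directlySampledImage n (Real.pi / 4) (1 / Real.sqrt 2) with hX
  set B := signedBlockSum (blockRow h) (blockCol h) blockSign Y with hB
  have h1 := sum_sq_signedBlockSum_le (blockRow_injective h) (blockCol_injective h)
    (s := blockSign) (by rintro ⟨b, x⟩; cases b <;> simp [blockSign]) (Y - X)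
  have h2 := sq_mul_sub_rank_le_sum_sq B ((L : ℝ) ^ 2)
  rw [signedBlockSum_sub, hX, signedBlockSum_directlySampledImage hn h, ← hX, ← hB,
    ← sq_frobenius_norm_eq_sum (Y - X)] at h1
  simp only [Matrix.sub_apply, Fintype.card_prod, Fintype.card_fin, Fintype.card_bool] at h1 h2
  have h3 : (B.rank : ℝ) ≤ k := by exact_mod_cast (rank_signedBlockSum_le _ _ _ Y).trans hY
  have hL' : (0 : ℝ) < (L : ℝ) ^ 2 := by positivity
  have h4 : ((L : ℝ) ^ 2) ^ 2 * ((r : ℝ) - k) ≤ ((L : ℝ) ^ 2) ^ 2 * ((r : ℝ) - B.rank) :=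
    mul_le_mul_of_nonneg_left (by linarith) (by positivity)
  push_cast at h1
  refine le_of_mul_le_mul_left ?_ hL'
  calc (L : ℝ) ^ 2 * ((L : ℝ) ^ 2 * ((r : ℝ) - k))
      = ((L : ℝ) ^ 2) ^ 2 * ((r : ℝ) - k) := by ring
    _ ≤ (L : ℝ) * (2 * L) * ‖Y - X‖ ^ 2 := h4.trans (h2.trans h1)
    _ = _ := by ring

/-- The norm of matrices below is the Frobenius norm. -/
theorem mainTheorem1 :
    ∃ c C C' : ℝ, 0 < c ∧ 0 < C ∧ 0 < C' ∧
      ∀ n k : ℕ, 2 ≤ n → max C (C' * (k : ℝ) ^ (9.5 : ℝ)) ≤ (n : ℝ) →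
        ∀ Xhat : Matrix (Fin n) (Fin n) ℝ, Xhat.rank ≤ k →
          c / (1 + (k : ℝ)) ≤
            1 / (n : ℝ) ^ 2 *
              ‖Xhat - directlySampledImage n (Real.pi / 4) (1 / Real.sqrt 2)‖ ^ 2 := by
  refine ⟨1 / 5000, 13, 25, by norm_num, by norm_num, by norm_num, ?_⟩
  intro n k hn hmax Y hY
  obtain ⟨hC, hC'⟩ := max_le_iff.1 hmax
  -- There is room for `2 * (k + 1)` groups of length at least `3`.
  have hnk : 12 * k + 13 ≤ n := by
    rcases Nat.eq_zero_or_pos k with rfl | hk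
    · exact_mod_cast hC
    · have hk1 : (1 : ℝ) ≤ k := by exact_mod_cast hk
      have hpow : (k : ℝ) ≤ (k : ℝ) ^ (9.5 : ℝ) := Real.self_le_rpow_of_one_le hk1 (by norm_num)
      have : (12 * k + 13 : ℝ) ≤ n := by linarith
      exact_mod_cast this
  set r := 2 * (k + 1) with hr
  set L := n / 2 / (3 * r) with hLdef
  have hL : 0 < L := Nat.div_pos (by omega) (by omega)
  have h : L * (3 * r) ≤ n / 2 := Nat.div_mul_le_self _ _
  have hlow : n ≤ 48 * (k + 1) * L := by
    have h1 : n / 2 < 3 * r * (L + 1) := Nat.lt_mul_div_succ _ (by omega)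
    have h2 : 3 * r * (L + 1) ≤ 3 * r * (2 * L) := Nat.mul_le_mul_left _ (by omega)
    have h3 : 3 * r * (2 * L) = 12 * ((k + 1) * L) := by rw [hr]; ring
    have h4 : 48 * (k + 1) * L = 48 * ((k + 1) * L) := by ring
    omega
  have hmain := sq_mul_sub_le_sq_norm_sub_directlySampledImage hn hL h hY
  set N := ‖Y - directlySampledImage n (Real.pi / 4) (1 / Real.sqrt 2)‖ ^ 2
  have hn0 : (0 : ℝ) < n := by exact_mod_cast (by omega : 0 < n)
  have hlow' : (n : ℝ) ≤ 48 * (k + 1) * L := by exact_mod_cast hlow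
  have hsq : (n : ℝ) ^ 2 ≤ (48 * (k + 1) * L) ^ 2 := pow_le_pow_left₀ hn0.le hlow' 2
  have hr' : (k : ℝ) + 1 ≤ (r : ℝ) - k := by rw [hr]; push_cast; linarith
  have h5 : (L : ℝ) ^ 2 * (k + 1) ≤ 2 * N :=
    (mul_le_mul_of_nonneg_left hr' (by positivity)).trans hmain
  have h6 : (L : ℝ) ^ 2 * (k + 1) * (k + 1) ≤ 2 * N * (k + 1) :=
    mul_le_mul_of_nonneg_right h5 (by positivity)
  rw [one_div_mul_eq_div, div_le_div_iff₀ (by positivity) (by positivity)]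
  have hN : 0 ≤ N * (1 + k) := mul_nonneg (sq_nonneg _) (by positivity)
  nlinarith
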